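/- Let $n\ge 1$ and let $r=(r_1,\dots,r_n)$ be a tuple of positive integers with $r_i\mid r_{i+1}$ for $1\le i\le n-1$. Put $\delta_r=\operatorname{diag}(r_1,\dots,r_n,1,\dots,1)\in \mathrm{GL}(2n;\mathbb R)$, $J=\begin{pmatrix}0&\mathrm{Id}_n\\-\mathrm{Id}_n&0\end{pmatrix}$, $\widetilde{\mathrm{Sp}}(2n;\mathbb R)=\{\beta\in \mathrm{GL}(2n;\mathbb R) : \beta^{t}J\beta=\pm J\}$ and $\Pi_r=\delta_r\,\mathrm{GL}(2n;\mathbb Z)\,\delta_r^{-1}\cap\widetilde{\mathrm{Sp}}(2n;\mathbb R)$. The group $\Pi_r$ acts from the right on the space $\mathcal P_{2n}$ of real symmetric positive definite $2n\times 2n$ matrices by $Y[\beta]=\beta^{t}Y\beta$; give $\mathcal P_{2n}/\Pi_r$ the quotient topology. For $Y\in\mathcal P_{2n}$ let $$m_r(Y)=\inf\{(\delta_r a)^{t}\,Y\,(\delta_r a) : a\in\mathbb Z^{2n}\setminus\{0\}\},$$ and let $0<d_1(Y)\le\dots\le d_n(Y)$ be the numbers such that the eigenvalues of $Y^{-1}J$,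 counted with multiplicity, are $\pm i\,d_k(Y)$, $1\le k\le n$. The functions $m_r$, $\det$ and $d_n$ are invariant under $\Pi_r$ and so induce functions on $\mathcal P_{2n}/\Pi_r$. Theorem 3.13. Let $M\subset\mathcal P_{2n}/\Pi_r$, and assume that there are positive constants $C_0,C_1,C_2$ such that $m_r([Y])\ge C_0$, $\det([Y])\le C_1$ and $d_n([Y])\le C_2$ for all $[Y]\in M$. Then $M$ has compact closure in $\mathcal P_{2n}/\Pi_r$. -/

import Mathlib

open Matrix

namespace HeisenbergModuli

/-- Index type of the coordinates `(x, y)` of `ℝ²ⁿ = ℝⁿ × ℝⁿ`. -/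
abbrev Idx (n : ℕ) : Type := Fin n ⊕ Fin n

/-- The matrix `J = (0, Id; -Id, 0)` of the standard symplectic form on `ℝ²ⁿ`. -/
def J (n : ℕ) : Matrix (Idx n) (Idx n) ℝ := Matrix.fromBlocks 0 1 (-1) 0

/-- The space `𝒫_{2n}` of real symmetric positive definite `2n × 2n` matrices, with the topology
induced from the space of all matrices. -/
abbrev PosDefMat (n : ℕ) : Type := {Y : Matrix (Idx n) (Idx n) ℝ // Y.PosDef}

/-- The right action `Y[β] = βᵀ Y β` of `GL(2n; ℝ)` on `𝒫_{2n}`. -/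
def pull {n : ℕ} (Y : PosDefMat n) (β : GL (Idx n) ℝ) : PosDefMat n :=
  ⟨(β : Matrix (Idx n) (Idx n) ℝ)ᵀ * Y.1 * (β : Matrix (Idx n) (Idx n) ℝ), by
    have h := Y.2.conjTranspose_mul_mul_same (B := (β : Matrix (Idx n) (Idx n) ℝ))
      (Matrix.mulVec_injective_iff_isUnit.2 β.isUnit)
    rwa [Matrix.conjTranspose_eq_transpose_of_trivial] at h⟩

/-- The right action of `GL(2n; ℝ)` on `𝒫_{2n}`, as an action of the opposite group. -/
instance instMulAction (n : ℕ) : MulAction (GL (Idx n) ℝ)ᵐᵒᵖ (PosDefMat n) where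
  smul β Y := pull Y β.unop
  one_smul Y := by
    apply Subtype.ext
    change (((1 : GL (Idx n) ℝ) : Matrix (Idx n) (Idx n) ℝ))ᵀ * Y.1 *
      ((1 : GL (Idx n) ℝ) : Matrix (Idx n) (Idx n) ℝ) = Y.1
    simp
  mul_smul a b Y := by
    apply Subtype.ext
    change ((b.unop * a.unop : GL (Idx n) ℝ) : Matrix (Idx n) (Idx n) ℝ)ᵀ * Y.1 *
      ((b.unop * a.unop : GL (Idx n) ℝ) : Matrix (Idx n) (Idx n) ℝ) =
      (a.unop : Matrix (Idx n) (Idx n) ℝ)ᵀ *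
        ((b.unop : Matrix (Idx n) (Idx n) ℝ)ᵀ * Y.1 * (b.unop : Matrix (Idx n) (Idx n) ℝ)) *
        (a.unop : Matrix (Idx n) (Idx n) ℝ)
    simp [Matrix.mul_assoc]

/-- The set `𝒟_n` of tuples `r = (r₁, …, r_n)` of positive integers with `r_i ∣ r_{i+1}`. -/
structure DivTuple (n : ℕ) where
  val : Fin n → ℕ
  pos : ∀ i, 0 < val i
  dvd : ∀ (i : ℕ) (h : i + 1 < n), val ⟨i, Nat.lt_of_succ_lt h⟩ ∣ val ⟨i + 1, h⟩

/-- The diagonal entries `(r₁, …, r_n, 1, …, 1)`. -/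
def DivTuple.diag {n : ℕ} (r : DivTuple n) : Idx n → ℝ :=
  Sum.elim (fun i => (r.val i : ℝ)) (fun _ => 1)

theorem DivTuple.diag_ne_zero {n : ℕ} (r : DivTuple n) (i : Idx n) : r.diag i ≠ 0 := by
  rcases i with i | i
  · simpa [DivTuple.diag] using (r.pos i).ne'
  · simp [DivTuple.diag]

/-- The matrix `δ_r = diag(r₁, …, r_n, 1, …, 1)`, as an element of `GL(2n; ℝ)`. -/
noncomputable def delta {n : ℕ} (r : DivTuple n) : GL (Idx n) ℝ :=
  Matrix.GeneralLinearGroup.mkOfDetNeZero (Matrix.diagonal r.diag) (by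
    rw [Matrix.det_diagonal]
    exact Finset.prod_ne_zero_iff.2 fun i _ => r.diag_ne_zero i)

/-- The group `GL(2n; ℤ)` inside `GL(2n; ℝ)`. -/
def GLInt (n : ℕ) : Subgroup (GL (Idx n) ℝ) :=
  (Matrix.GeneralLinearGroup.map (n := Idx n) (Int.castRingHom ℝ)).range

/-- The group `G_r = δ_r GL(2n; ℤ) δ_r⁻¹`. -/
noncomputable def Gr {n : ℕ} (r : DivTuple n) : Subgroup (GL (Idx n) ℝ) :=
  (GLInt n).map (MulAut.conj (delta r)).toMonoidHom

/-- The group of all `β ∈ GL(2n; ℝ)` with `βᵀ J β = J` or `βᵀ J β = -J`. -/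
def SpTilde (n : ℕ) : Subgroup (GL (Idx n) ℝ) where
  carrier := {β | (β : Matrix (Idx n) (Idx n) ℝ)ᵀ * J n * (β : Matrix (Idx n) (Idx n) ℝ) = J n ∨
    (β : Matrix (Idx n) (Idx n) ℝ)ᵀ * J n * (β : Matrix (Idx n) (Idx n) ℝ) = -J n}
  one_mem' := by simp
  mul_mem' := by
    intro a b ha hb
    have key : ((a * b : GL (Idx n) ℝ) : Matrix (Idx n) (Idx n) ℝ)ᵀ * J n *
        ((a * b : GL (Idx n) ℝ) : Matrix (Idx n) (Idx n) ℝ) =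
        (b : Matrix (Idx n) (Idx n) ℝ)ᵀ * ((a : Matrix (Idx n) (Idx n) ℝ)ᵀ * J n *
          (a : Matrix (Idx n) (Idx n) ℝ)) * (b : Matrix (Idx n) (Idx n) ℝ) := by
      simp [Matrix.mul_assoc]
    simp only [Set.mem_ofPred_eq] at ha hb ⊢
    rw [key]
    rcases ha with ha | ha <;> rcases hb with hb | hb <;> simp [ha, hb]
  inv_mem' := by
    intro a ha
    have h1 : (a : Matrix (Idx n) (Idx n) ℝ) *
        ((a⁻¹ : GL (Idx n) ℝ) : Matrix (Idx n) (Idx n) ℝ) = 1 := by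
      rw [← Units.val_mul, mul_inv_cancel, Units.val_one]
    have h2 : ((a⁻¹ : GL (Idx n) ℝ) : Matrix (Idx n) (Idx n) ℝ)ᵀ *
        (a : Matrix (Idx n) (Idx n) ℝ)ᵀ = 1 := by
      rw [← Matrix.transpose_mul, h1, Matrix.transpose_one]
    have key : ((a⁻¹ : GL (Idx n) ℝ) : Matrix (Idx n) (Idx n) ℝ)ᵀ *
        ((a : Matrix (Idx n) (Idx n) ℝ)ᵀ * J n * (a : Matrix (Idx n) (Idx n) ℝ)) *
        ((a⁻¹ : GL (Idx n) ℝ) : Matrix (Idx n) (Idx n) ℝ) = J n := by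
      calc _ = (((a⁻¹ : GL (Idx n) ℝ) : Matrix (Idx n) (Idx n) ℝ)ᵀ *
            (a : Matrix (Idx n) (Idx n) ℝ)ᵀ) * J n * ((a : Matrix (Idx n) (Idx n) ℝ) *
            ((a⁻¹ : GL (Idx n) ℝ) : Matrix (Idx n) (Idx n) ℝ)) := by
              simp only [Matrix.mul_assoc]
        _ = J n := by rw [h1, h2, Matrix.one_mul, Matrix.mul_one]
    simp only [Set.mem_ofPred_eq] at ha ⊢
    rcases ha with ha | ha
    · left
      rw [ha] at key
      exact key
    · right
      rw [ha, Matrix.mul_neg, Matrix.neg_mul] at key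
      rw [← key, neg_neg, key]

/-- The group `Π_r = G_r ∩ Sp~(2n; ℝ)`. -/
noncomputable def PiGroup {n : ℕ} (r : DivTuple n) : Subgroup (GL (Idx n) ℝ) :=
  Gr r ⊓ SpTilde n

/-- The orbit relation of the right action of `Π_r` on `𝒫_{2n}`. -/
noncomputable def orbitSetoid {n : ℕ} (r : DivTuple n) : Setoid (PosDefMat n) :=
  MulAction.orbitRel (PiGroup r).op (PosDefMat n)

/-- The moduli space `𝒫_{2n} / Π_r`; as a `Quotient` it carries the quotient topology. -/
abbrev ModuliSpace {n : ℕ} (r : DivTuple n) : Type := Quotient (orbitSetoid r)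

theorem orbitSetoid_iff {n : ℕ} (r : DivTuple n) (X Y : PosDefMat n) :
    (orbitSetoid r) X Y ↔ ∃ β ∈ PiGroup r, pull Y β = X := by
  constructor
  · rintro ⟨g, hg⟩
    exact ⟨g.1.unop, g.2, hg⟩
  · rintro ⟨β, hβ, h⟩
    exact ⟨⟨MulOpposite.op β, hβ⟩, h⟩

/-- The quadratic form `Y[a] = aᵀ Y a`. -/
def quadForm {n : ℕ} (Y : PosDefMat n) (a : Idx n → ℝ) : ℝ := a ⬝ᵥ (Y.1 *ᵥ a)

/-- `m_r(Y) = inf {Y[δ_r a] | a ∈ ℤ²ⁿ, a ≠ 0}`. -/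
noncomputable def mr {n : ℕ} (r : DivTuple n) (Y : PosDefMat n) : ℝ :=
  ⨅ a : {a : Idx n → ℤ // a ≠ 0},
    quadForm Y ((delta r : Matrix (Idx n) (Idx n) ℝ) *ᵥ fun i => (a.1 i : ℝ))

/-- The multiset of the complex eigenvalues of `Y⁻¹ J`, with algebraic multiplicities. -/
noncomputable def eigs {n : ℕ} (Y : PosDefMat n) : Multiset ℂ :=
  ((Y.1⁻¹ * J n).charpoly.map (algebraMap ℝ ℂ)).roots

/-- The numbers `d_1(Y) ≤ … ≤ d_n(Y)` (here indexed by `0, …, n - 1`): the eigenvalues of `Y⁻¹ J`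
are `± i d_k(Y)`, so that the `d_k(Y)` are the imaginary parts of the eigenvalues in the upper
half plane, listed with multiplicity in increasing order. -/
noncomputable def d {n : ℕ} (Y : PosDefMat n) (k : Fin n) : ℝ :=
  ((((eigs Y).filter fun z => 0 < z.im).map Complex.im).sort (· ≤ ·)).getD k 0

theorem det_inv_mul_J_ne_zero {n : ℕ} (Y : PosDefMat n) : (Y.1⁻¹ * J n).det ≠ 0 := by
  have hJ : J n * J n = -1 := by
    simp [J, Matrix.fromBlocks_multiply, ← Matrix.fromBlocks_one, Matrix.fromBlocks_neg]
  have hJd : (J n).det ≠ 0 := by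
    intro h
    have h2 := congrArg Matrix.det hJ
    rw [Matrix.det_mul, h, Matrix.det_neg] at h2
    simp at h2
  rw [Matrix.det_mul]
  exact mul_ne_zero (Y.2.inv.det_pos.ne') hJd

/-- The eigenvalues of `Y⁻¹ J` are purely imaginary and nonzero. -/
theorem re_eq_zero_of_mem_eigs {n : ℕ} (Y : PosDefMat n) {z : ℂ} (hz : z ∈ eigs Y) :
    z.re = 0 ∧ z.im ≠ 0 := by
  have hroot : (((Y.1⁻¹ * J n).map (algebraMap ℝ ℂ)).charpoly).IsRoot z := by
    rw [Matrix.charpoly_map]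
    exact Polynomial.isRoot_of_mem_roots hz
  have hz0 : z ≠ 0 := by
    rintro rfl
    have h0 : ((Y.1⁻¹ * J n).map (algebraMap ℝ ℂ)).det = 0 := by
      rw [Matrix.det_eq_sign_charpoly_coeff, Polynomial.coeff_zero_eq_eval_zero]
      rw [Polynomial.IsRoot.def] at hroot
      rw [hroot, mul_zero]
    have h1 : ((Y.1⁻¹ * J n).map (algebraMap ℝ ℂ)).det = algebraMap ℝ ℂ (Y.1⁻¹ * J n).det :=
      ((algebraMap ℝ ℂ).map_det _).symm
    rw [h1] at h0
    exact det_inv_mul_J_ne_zero Y (by simpa using h0)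
  obtain ⟨v, hv0, hv⟩ : ∃ v : Idx n → ℂ, v ≠ 0 ∧
      ((Y.1⁻¹ * J n).map (algebraMap ℝ ℂ)) *ᵥ v = z • v := by
    have hev := (Matrix.mem_spectrum_iff_isRoot_charpoly
      (A := (Y.1⁻¹ * J n).map (algebraMap ℝ ℂ)) (r := z)).2 hroot
    rw [← Matrix.spectrum_toLin', ← Module.End.hasEigenvalue_iff_mem_spectrum] at hev
    obtain ⟨v, hv⟩ := hev.exists_hasEigenvector
    exact ⟨v, hv.2, by simpa using hv.apply_eq_smul⟩
  let Yc : Matrix (Idx n) (Idx n) ℂ := Y.1.map (algebraMap ℝ ℂ)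
  let Jc : Matrix (Idx n) (Idx n) ℂ := (J n).map (algebraMap ℝ ℂ)
  have hYJ : Jc *ᵥ v = z • (Yc *ᵥ v) := by
    rw [← Matrix.mulVec_smul, ← hv, Matrix.mulVec_mulVec]
    congr 1
    simp only [Yc, Jc]
    rw [← Matrix.map_mul, Matrix.mul_nonsing_inv_cancel_left _ _ (Y.2.isUnit.map Matrix.detMonoidHom)]
  have hYH : Yc.IsHermitian := by
    have := Y.2.1
    ext i j
    have h2 := congrFun (congrFun this i) j
    simp only [Matrix.conjTranspose_apply, star_trivial] at h2
    simp [Yc, Matrix.conjTranspose_apply, h2]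
  have hq : star v ⬝ᵥ (Yc *ᵥ v) ≠ 0 := by
    have hre : (star v ⬝ᵥ (Yc *ᵥ v)).re =
        (fun i => (v i).re) ⬝ᵥ (Y.1 *ᵥ fun i => (v i).re) +
        (fun i => (v i).im) ⬝ᵥ (Y.1 *ᵥ fun i => (v i).im) := by
      simp only [dotProduct, Matrix.mulVec, Complex.re_sum, Yc, Complex.mul_re, Matrix.map_apply,
        Complex.im_sum, Complex.mul_im, ← Finset.sum_add_distrib]
      refine Finset.sum_congr rfl fun i _ => ?_
      simp
    have hnn : ∀ w : Idx n → ℝ, 0 ≤ w ⬝ᵥ (Y.1 *ᵥ w) := fun w => by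
      simpa using Y.2.posSemidef.dotProduct_mulVec_nonneg w
    have hpos : ∀ w : Idx n → ℝ, w ≠ 0 → 0 < w ⬝ᵥ (Y.1 *ᵥ w) := fun w hw => by
      simpa using Y.2.dotProduct_mulVec_pos hw
    intro h0
    rw [h0, Complex.zero_re] at hre
    by_cases hr : (fun i => (v i).re) = 0
    · have hi : (fun i => (v i).im) ≠ 0 := by
        intro hi
        apply hv0
        ext i
        exact Complex.ext (congrFun hr i) (congrFun hi i)
      linarith [hnn (fun i => (v i).re), hpos _ hi]
    · linarith [hnn (fun i => (v i).im), hpos _ hr]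
  have hJ : Jcᴴ = -Jc := by
    have : (J n)ᵀ = -J n := by
      simp [J, Matrix.fromBlocks_transpose, Matrix.fromBlocks_neg]
    ext i j
    have h2 := congrFun (congrFun this i) j
    simp only [Matrix.transpose_apply, Matrix.neg_apply] at h2
    simp [Jc, Matrix.conjTranspose_apply, h2]
  have hst : ∀ A : Matrix (Idx n) (Idx n) ℂ,
      star (star v ⬝ᵥ (A *ᵥ v)) = star v ⬝ᵥ (Aᴴ *ᵥ v) := fun A => by
    rw [← Matrix.star_dotProduct_star, star_star, Matrix.star_mulVec, Matrix.dotProduct_mulVec]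
  have hs1 : star (star v ⬝ᵥ (Yc *ᵥ v)) = star v ⬝ᵥ (Yc *ᵥ v) := by
    rw [hst, hYH.eq]
  have hs2 : star (star v ⬝ᵥ (Jc *ᵥ v)) = -(star v ⬝ᵥ (Jc *ᵥ v)) := by
    rw [hst, hJ, Matrix.neg_mulVec, dotProduct_neg]
  rw [hYJ, dotProduct_smul, smul_eq_mul, star_mul', hs1, ← neg_mul] at hs2
  have hzz := mul_right_cancel₀ hq hs2
  have hre : z.re = 0 := by
    have := congrArg Complex.re hzz
    simp at this
    linarith
  exact ⟨hre, fun him => hz0 (Complex.ext hre him)⟩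

theorem eigs_conj {n : ℕ} (Y : PosDefMat n) : (eigs Y).map (starRingEnd ℂ) = eigs Y := by
  have hs := IsAlgClosed.splits ((Y.1⁻¹ * J n).charpoly.map (algebraMap ℝ ℂ))
  have h := hs.roots_map (starRingEnd ℂ)
  rw [Polynomial.map_map] at h
  have hc : (starRingEnd ℂ).comp (algebraMap ℝ ℂ) = algebraMap ℝ ℂ := by
    ext x
    simp
  rw [hc] at h
  exact h.symm

theorem eigs_eq_add {n : ℕ} (Y : PosDefMat n) :
    eigs Y = ((eigs Y).filter fun z => 0 < z.im) +
      ((eigs Y).filter fun z => 0 < z.im).map (starRingEnd ℂ) := by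
  have h2 : ((eigs Y).filter fun z => 0 < z.im).map (starRingEnd ℂ) =
      (eigs Y).filter fun z => ¬ 0 < z.im := by
    conv_rhs => rw [← eigs_conj Y, Multiset.filter_map]
    congr 1
    refine Multiset.filter_congr fun z hz => ?_
    have := (re_eq_zero_of_mem_eigs Y hz).2
    simp only [Function.comp, Complex.conj_im, not_lt]
    constructor
    · intro h; linarith
    · intro h; exact lt_of_le_of_ne (by linarith) this.symm
  rw [h2, Multiset.filter_add_not]

theorem card_upper_eigs {n : ℕ} (Y : PosDefMat n) :
    ((eigs Y).filter fun z => 0 < z.im).card = n := by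
  have h := congrArg Multiset.card (eigs_eq_add Y)
  have hs := (IsAlgClosed.splits
    ((Y.1⁻¹ * J n).charpoly.map (algebraMap ℝ ℂ))).natDegree_eq_card_roots
  rw [Polynomial.natDegree_map, Matrix.charpoly_natDegree_eq_dim] at hs
  rw [Multiset.card_add, Multiset.card_map] at h
  change Fintype.card (Idx n) = (eigs Y).card at hs
  simp only [Fintype.card_sum, Fintype.card_fin] at hs
  omega

theorem ofFn_d {n : ℕ} (Y : PosDefMat n) :
    List.ofFn (d Y) =
      (((eigs Y).filter fun z => 0 < z.im).map Complex.im).sort (· ≤ ·) := by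
  have hl : ((((eigs Y).filter fun z => 0 < z.im).map Complex.im).sort (· ≤ ·)).length = n := by
    rw [Multiset.length_sort, Multiset.card_map, card_upper_eigs]
  refine List.ext_getElem (by simp [hl]) fun i h1 h2 => ?_
  rw [List.getElem_ofFn]
  exact List.getD_eq_getElem _ _ h2

/-- `d_1(Y) ≤ … ≤ d_n(Y)`. -/
theorem d_monotone {n : ℕ} (Y : PosDefMat n) : Monotone (d Y) := by
  rw [← List.sortedLE_ofFn_iff, ofFn_d]
  exact (Multiset.pairwise_sort _ _).sortedLE

/-- The `d_k(Y)` are positive. -/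
theorem d_pos {n : ℕ} (Y : PosDefMat n) (k : Fin n) : 0 < d Y k := by
  have h : d Y k ∈ List.ofFn (d Y) := (List.mem_ofFn' _ _).2 ⟨k, rfl⟩
  rw [ofFn_d, Multiset.mem_sort, Multiset.mem_map] at h
  obtain ⟨z, hz, h⟩ := h
  rw [← h]
  exact (Multiset.mem_filter.1 hz).2

/-- The eigenvalues of `Y⁻¹ J`, with multiplicities, are the numbers `± i d_k(Y)`. -/
theorem charpoly_eq_prod_d {n : ℕ} (Y : PosDefMat n) :
    (Y.1⁻¹ * J n).charpoly.map (algebraMap ℝ ℂ) =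
      ∏ k : Fin n, ((Polynomial.X - Polynomial.C (Complex.I * (d Y k : ℂ))) *
        (Polynomial.X - Polynomial.C (-(Complex.I * (d Y k : ℂ))))) := by
  have hm : Multiset.map (d Y) Finset.univ.val =
      ((eigs Y).filter fun z => 0 < z.im).map Complex.im := by
    have h := congrArg (fun l : List ℝ => (l : Multiset ℝ)) (ofFn_d Y)
    simp only [Multiset.sort_eq] at h
    rw [← h, ← Fin.univ_val_map]
  have hp := (IsAlgClosed.splits
    ((Y.1⁻¹ * J n).charpoly.map (algebraMap ℝ ℂ))).eq_prod_roots_of_monic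
      ((Matrix.charpoly_monic _).map _)
  change _ = ((eigs Y).map fun z => Polynomial.X - Polynomial.C z).prod at hp
  rw [hp, eigs_eq_add, Multiset.map_add, Multiset.prod_add, Multiset.map_map,
    ← Multiset.prod_map_mul]
  have hf : (∏ k : Fin n, ((Polynomial.X - Polynomial.C (Complex.I * (d Y k : ℂ))) *
        (Polynomial.X - Polynomial.C (-(Complex.I * (d Y k : ℂ)))))) =
      ((Multiset.map (d Y) Finset.univ.val).map fun t : ℝ =>
        ((Polynomial.X - Polynomial.C (Complex.I * (t : ℂ))) *
        (Polynomial.X - Polynomial.C (-(Complex.I * (t : ℂ)))))).prod := by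
    rw [Multiset.map_map]
    rfl
  rw [hf, hm, Multiset.map_map]
  congr 1
  refine Multiset.map_congr rfl fun z hz => ?_
  have hre := (re_eq_zero_of_mem_eigs Y (Multiset.mem_filter.1 hz).1).1
  have h1 : Complex.I * (z.im : ℂ) = z := Complex.ext (by simp [hre]) (by simp)
  have h2 : -z = (starRingEnd ℂ) z := Complex.ext (by simp [hre]) (by simp)
  simp only [Function.comp, h1, h2]

theorem charpoly_pull {n : ℕ} (Y : PosDefMat n) {β : GL (Idx n) ℝ} (hβ : β ∈ SpTilde n) :
    ((pull Y β).1⁻¹ * J n).charpoly = (Y.1⁻¹ * J n).charpoly := by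
  have hinv := (SpTilde n).inv_mem hβ
  set b : Matrix (Idx n) (Idx n) ℝ := (β : Matrix (Idx n) (Idx n) ℝ) with hb
  have hbi : ((β⁻¹ : GL (Idx n) ℝ) : Matrix (Idx n) (Idx n) ℝ) = b⁻¹ := by
    rw [Matrix.coe_units_inv]
  have h1 : ((pull Y β).1⁻¹ * J n) = b⁻¹ * (Y.1⁻¹ * (b⁻¹ᵀ * J n)) := by
    change (bᵀ * Y.1 * b)⁻¹ * J n = _
    rw [Matrix.mul_inv_rev, Matrix.mul_inv_rev, Matrix.transpose_nonsing_inv]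
    simp only [Matrix.mul_assoc]
  have hJt : (J n)ᵀ = -J n := by
    simp [J, Matrix.fromBlocks_transpose, Matrix.fromBlocks_neg]
  have hYt : Y.1ᵀ = Y.1 := by
    simpa [Matrix.conjTranspose_eq_transpose_of_trivial] using Y.2.1.eq
  rw [h1, Matrix.charpoly_mul_comm, Matrix.mul_assoc]
  rcases hinv with h | h
  · rw [hbi] at h
    rw [h]
  · rw [hbi] at h
    rw [h, ← Matrix.charpoly_transpose, Matrix.transpose_mul, Matrix.transpose_neg, hJt, neg_neg,
      Matrix.transpose_nonsing_inv, hYt, Matrix.charpoly_mul_comm]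

theorem d_pull {n : ℕ} (Y : PosDefMat n) {β : GL (Idx n) ℝ} (hβ : β ∈ SpTilde n) (k : Fin n) :
    d (pull Y β) k = d Y k := by
  simp only [d, eigs, charpoly_pull Y hβ]

theorem exists_of_mem_Gr {n : ℕ} (r : DivTuple n) {β : GL (Idx n) ℝ} (hβ : β ∈ Gr r) :
    ∃ A : GL (Idx n) ℤ, β * delta r =
      delta r * Matrix.GeneralLinearGroup.map (n := Idx n) (Int.castRingHom ℝ) A := by
  obtain ⟨_, ⟨A, rfl⟩, rfl⟩ := hβ
  exact ⟨A, by simp⟩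

theorem det_pull {n : ℕ} (r : DivTuple n) (Y : PosDefMat n) {β : GL (Idx n) ℝ} (hβ : β ∈ Gr r) :
    (pull Y β).1.det = Y.1.det := by
  obtain ⟨A, hA⟩ := exists_of_mem_Gr r hβ
  have h := congrArg (fun g : GL (Idx n) ℝ => (g : Matrix (Idx n) (Idx n) ℝ).det) hA
  simp only [Units.val_mul, Matrix.det_mul] at h
  have hd : (delta r : Matrix (Idx n) (Idx n) ℝ).det ≠ 0 :=
    ((Matrix.isUnit_iff_isUnit_det _).1 (delta r).isUnit).ne_zero
  have h2 : (β : Matrix (Idx n) (Idx n) ℝ).det =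
      ((A : Matrix (Idx n) (Idx n) ℤ).det : ℝ) := by
    rw [mul_comm] at h
    rw [mul_left_cancel₀ hd h]
    exact ((Int.castRingHom ℝ).map_det _).symm
  have h3 : (A : Matrix (Idx n) (Idx n) ℤ).det * (A : Matrix (Idx n) (Idx n) ℤ).det = 1 :=
    Int.isUnit_mul_self ((Matrix.isUnit_iff_isUnit_det _).1 A.isUnit)
  change ((β : Matrix (Idx n) (Idx n) ℝ)ᵀ * Y.1 * (β : Matrix (Idx n) (Idx n) ℝ)).det = _
  rw [Matrix.det_mul, Matrix.det_mul, Matrix.det_transpose, h2, mul_right_comm]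
  have h4 : ((A : Matrix (Idx n) (Idx n) ℤ).det : ℝ) * ((A : Matrix (Idx n) (Idx n) ℤ).det : ℝ) = 1 := by
    exact_mod_cast h3
  rw [h4, one_mul]

theorem quadForm_pull {n : ℕ} (Y : PosDefMat n) (β : GL (Idx n) ℝ) (a : Idx n → ℝ) :
    quadForm (pull Y β) a = quadForm Y ((β : Matrix (Idx n) (Idx n) ℝ) *ᵥ a) := by
  change a ⬝ᵥ (((β : Matrix (Idx n) (Idx n) ℝ)ᵀ * Y.1 * (β : Matrix (Idx n) (Idx n) ℝ)) *ᵥ a) = _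
  rw [quadForm, ← Matrix.mulVec_mulVec, ← Matrix.mulVec_mulVec, Matrix.dotProduct_mulVec,
    Matrix.vecMul_transpose]

theorem mr_pull {n : ℕ} (r : DivTuple n) (Y : PosDefMat n) {β : GL (Idx n) ℝ} (hβ : β ∈ Gr r) :
    mr r (pull Y β) = mr r Y := by
  obtain ⟨A, hA⟩ := exists_of_mem_Gr r hβ
  have hinj : Function.Injective fun a : Idx n → ℤ => (A : Matrix (Idx n) (Idx n) ℤ) *ᵥ a := by
    intro a b hab
    have h := congrArg
      (fun v => ((A⁻¹ : GL (Idx n) ℤ) : Matrix (Idx n) (Idx n) ℤ) *ᵥ v) hab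
    simpa only [Matrix.mulVec_mulVec, ← Units.val_mul, inv_mul_cancel, Units.val_one,
      Matrix.one_mulVec] using h
  let f : {a : Idx n → ℤ // a ≠ 0} → {a : Idx n → ℤ // a ≠ 0} := fun a =>
    ⟨(A : Matrix (Idx n) (Idx n) ℤ) *ᵥ a.1, fun h => a.2 (hinj (by simpa using h))⟩
  have hf : Function.Surjective f := by
    intro b
    refine ⟨⟨((A⁻¹ : GL (Idx n) ℤ) : Matrix (Idx n) (Idx n) ℤ) *ᵥ b.1, fun h => b.2 ?_⟩, ?_⟩
    · have h' := congrArg (fun v => (A : Matrix (Idx n) (Idx n) ℤ) *ᵥ v) h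
      simpa only [Matrix.mulVec_mulVec, ← Units.val_mul, mul_inv_cancel, Units.val_one,
        Matrix.one_mulVec, Matrix.mulVec_zero] using h'
    · apply Subtype.ext
      simp only [f, Matrix.mulVec_mulVec, ← Units.val_mul, mul_inv_cancel, Units.val_one,
        Matrix.one_mulVec]
  refine hf.iInf_congr f fun a => ?_
  have hcast : (fun i => (((f a).1 i : ℤ) : ℝ)) =
      (Matrix.GeneralLinearGroup.map (n := Idx n) (Int.castRingHom ℝ) A :
        Matrix (Idx n) (Idx n) ℝ) *ᵥ fun i => (a.1 i : ℝ) := by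
    ext i
    simp [f, Matrix.mulVec, dotProduct]
  rw [quadForm_pull, hcast, Matrix.mulVec_mulVec, Matrix.mulVec_mulVec, ← Units.val_mul,
    ← Units.val_mul, hA]

/-- The function induced by `m_r` on `𝒫_{2n} / Π_r`. -/
noncomputable def ModuliSpace.mr {n : ℕ} {r : DivTuple n} : ModuliSpace r → ℝ :=
  Quotient.lift (HeisenbergModuli.mr r) fun X Y h => by
    obtain ⟨β, hβ, rfl⟩ := (orbitSetoid_iff r X Y).1 h
    exact mr_pull r Y hβ.1

/-- The function induced by the determinant on `𝒫_{2n} / Π_r`. -/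
noncomputable def ModuliSpace.det {n : ℕ} {r : DivTuple n} : ModuliSpace r → ℝ :=
  Quotient.lift (fun Y : PosDefMat n => Y.1.det) fun X Y h => by
    obtain ⟨β, hβ, rfl⟩ := (orbitSetoid_iff r X Y).1 h
    exact det_pull r Y hβ.1

/-- The function induced by `d_k` on `𝒫_{2n} / Π_r`. -/
noncomputable def ModuliSpace.d {n : ℕ} {r : DivTuple n} (k : Fin n) : ModuliSpace r → ℝ :=
  Quotient.lift (fun Y : PosDefMat n => HeisenbergModuli.d Y k) fun X Y h => by
    obtain ⟨β, hβ, rfl⟩ := (orbitSetoid_iff r X Y).1 h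
    exact d_pull Y hβ.2 k

end HeisenbergModuli

open Matrix

/-! If `Π_r` were all of `G_r`, this would be Mahler's compactness criterion: a lower bound on the
minimum and an upper bound on the determinant bring each form, after a change of basis of the
lattice `δ_r ℤ²ⁿ`, into a fixed compact set `K` (`hasCompactReduction`, proved by Hermite's
induction on the dimension).

The basis change `A` need not respect `J`: it turns the integral Gram matrix of `J` on the lattice
into another integral skew matrix `T`. The bound on `d_n` controls `T`. Since `det (Y - J) = det Y *
∏ (1 + d_k²)`, it bounds the size of `J` relative to `Y`; with `Y` moved into `K`, this bounds the
entries of `T` (`abs_apply_le_of_det_sub_sq_le`). So only finitely many `T` occur. Fix one basis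
change `B T` for each: two basis changes with the same `T` differ by an element of `Π_r`
(`mul_inv_mem_PiGroup`), so `Y` is `Π_r`-equivalent to a point of one of finitely many translates of
`K` (`exists_compact_representatives`).

For the closure of `M`, the bounds are restated as closed conditions on `Y` (`boundedForms`), and
openness of the quotient map lets preimage and closure commute. -/

namespace HeisenbergModuli

/-! ### Reduction theory of positive definite forms under integral equivalence -/

section Reduction

variable {ι : Type*} [Fintype ι]

/-- The congruence action `Z ↦ Aᵀ Z A` of integral matrices on real matrices. -/
def intCongr (A : Matrix ι ι ℤ) (Z : Matrix ι ι ℝ) : Matrix ι ι ℝ :=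
  (A.map (Int.cast : ℤ → ℝ))ᵀ * Z * A.map (Int.cast : ℤ → ℝ)

theorem intCongr_apply_self (A : Matrix ι ι ℤ) (Z : Matrix ι ι ℝ) (j : ι) :
    intCongr A Z j j = (fun i => (A.col j i : ℝ)) ⬝ᵥ (Z *ᵥ fun i => (A.col j i : ℝ)) := by
  rw [intCongr, Matrix.mul_assoc]
  rfl

theorem map_intCast_mul (A B : Matrix ι ι ℤ) :
    (A * B).map (Int.cast : ℤ → ℝ) = A.map Int.cast * B.map Int.cast :=
  Matrix.map_mul (f := Int.castRingHom ℝ)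

theorem intCongr_mul (A B : Matrix ι ι ℤ) (Z : Matrix ι ι ℝ) :
    intCongr (A * B) Z = intCongr B (intCongr A Z) := by
  simp only [intCongr, map_intCast_mul, Matrix.transpose_mul, Matrix.mul_assoc]

theorem det_map_intCast [DecidableEq ι] (A : Matrix ι ι ℤ) :
    (A.map (Int.cast : ℤ → ℝ)).det = (A.det : ℝ) :=
  ((Int.castRingHom ℝ).map_det A).symm

theorem det_intCongr [DecidableEq ι] {A : Matrix ι ι ℤ} (hA : IsUnit A.det) (Z : Matrix ι ι ℝ) :
    (intCongr A Z).det = Z.det := by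
  have h : (A.det : ℝ) * A.det = 1 := by exact_mod_cast Int.isUnit_mul_self hA
  rw [intCongr, Matrix.det_mul, Matrix.det_mul, Matrix.det_transpose, det_map_intCast,
    mul_right_comm, h, one_mul]

theorem isUnit_map_intCast [DecidableEq ι] {A : Matrix ι ι ℤ} (hA : IsUnit A.det) :
    IsUnit (A.map (Int.cast : ℤ → ℝ)) := by
  rw [Matrix.isUnit_iff_isUnit_det, det_map_intCast]
  exact hA.map (Int.castRingHom ℝ)

theorem posDef_congr [DecidableEq ι] {Z B : Matrix ι ι ℝ} (hZ : Z.PosDef) (hB : IsUnit B) :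
    (Bᵀ * Z * B).PosDef := by
  have h := hZ.conjTranspose_mul_mul_same (B := B) (Matrix.mulVec_injective_iff_isUnit.2 hB)
  rwa [Matrix.conjTranspose_eq_transpose_of_trivial] at h

theorem posDef_intCongr [DecidableEq ι] {A : Matrix ι ι ℤ} (hA : IsUnit A.det)
    {Z : Matrix ι ι ℝ} (hZ : Z.PosDef) : (intCongr A Z).PosDef :=
  posDef_congr hZ (isUnit_map_intCast hA)

theorem intCongr_submatrix {κ : Type*} [Fintype κ] (e : κ ≃ ι) (A : Matrix κ κ ℤ)
    (Z : Matrix ι ι ℝ) :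
    intCongr (A.submatrix e.symm e.symm) Z =
      (intCongr A (Z.submatrix e e)).submatrix e.symm e.symm := by
  have hZ : Z = (Z.submatrix e e).submatrix e.symm e.symm := by ext; simp
  conv_lhs => rw [hZ]
  simp only [intCongr, ← Matrix.submatrix_map, Matrix.transpose_submatrix,
    Matrix.submatrix_mul_equiv]

/-- Permuting the columns of a unimodular matrix keeps it unimodular, so any diagonal entry may be
moved to a prescribed position. -/
theorem exists_isUnit_intCongr_apply_eq [DecidableEq ι] {A : Matrix ι ι ℤ} (hA : IsUnit A.det)
    (Z : Matrix ι ι ℝ) (i j : ι) :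
    ∃ B : Matrix ι ι ℤ, IsUnit B.det ∧ intCongr B Z i i = intCongr A Z j j := by
  refine ⟨A.submatrix id (Equiv.swap i j), ?_, ?_⟩
  · rw [Matrix.det_permute']
    exact IsUnit.mul (Units.isUnit _) hA
  · have h : intCongr (A.submatrix id (Equiv.swap i j)) Z =
        (intCongr A Z).submatrix (Equiv.swap i j) (Equiv.swap i j) := by
      ext k l
      simp [intCongr, Matrix.mul_apply]
    simp [h]

/-- Reduction theory for positive definite forms: the forms of bounded determinant whose values on
primitive integral vectors are bounded below are, up to integral equivalence, contained in a compact
set. -/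
def HasCompactReduction (ι : Type*) [Fintype ι] : Prop :=
  ∀ [DecidableEq ι] (c D : ℝ), 0 < c → ∃ K : Set (Matrix ι ι ℝ), IsCompact K ∧
    (∀ Z ∈ K, Z.PosDef) ∧ ∀ Z : Matrix ι ι ℝ, Z.PosDef →
      (∀ A : Matrix ι ι ℤ, IsUnit A.det → ∀ j, c ≤ intCongr A Z j j) → Z.det ≤ D →
      ∃ A : Matrix ι ι ℤ, IsUnit A.det ∧ intCongr A Z ∈ K

theorem HasCompactReduction.of_equiv {κ : Type*} [Fintype κ] (e : κ ≃ ι)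
    (h : HasCompactReduction κ) : HasCompactReduction ι := by
  classical
  intro _ c D hc
  obtain ⟨K, hK, hpos, hred⟩ := h c D hc
  refine ⟨(fun Z => Z.submatrix e.symm e.symm) '' K, hK.image (by fun_prop), ?_, ?_⟩
  · rintro _ ⟨Z, hZ, rfl⟩
    exact (hpos Z hZ).submatrix e.symm.injective
  · intro Z hZ hmin hdet
    have hu : ∀ A : Matrix κ κ ℤ, IsUnit A.det → IsUnit (A.submatrix e.symm e.symm).det := by
      intro A hA
      rwa [Matrix.det_submatrix_equiv_self]
    obtain ⟨A, hA, hAK⟩ := hred (Z.submatrix e e) (hZ.submatrix e.injective)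
      (fun A hA j => by
        have := hmin _ (hu A hA) (e j)
        rw [intCongr_submatrix] at this
        simpa using this)
      (by rwa [Matrix.det_submatrix_equiv_self])
    exact ⟨_, hu A hA, _, hAK, (intCongr_submatrix e A Z).symm⟩

theorem HasCompactReduction.of_isEmpty [IsEmpty ι] : HasCompactReduction ι := by
  intro _ c D _
  refine ⟨{1}, isCompact_singleton, fun Z hZ => hZ ▸ Matrix.PosDef.one, fun Z _ _ _ => ?_⟩
  exact ⟨1, by simp, Subsingleton.elim _ _⟩

/-! ### Splitting off one variable, and the induction on the dimension -/

/-- The unipotent matrix with first row `(1, u)`. -/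
def unipotent {R : Type*} [Zero R] [One R] [DecidableEq ι] (u : ι → R) :
    Matrix (Unit ⊕ ι) (Unit ⊕ ι) R :=
  Matrix.fromBlocks 1 (Matrix.replicateRow Unit u) 0 1

/-- The form `d (x₀ + u x)² + W[x]`. -/
def jacobiForm [DecidableEq ι] (d : ℝ) (u : ι → ℝ) (W : Matrix ι ι ℝ) :
    Matrix (Unit ⊕ ι) (Unit ⊕ ι) ℝ :=
  (unipotent u)ᵀ * Matrix.fromBlocks (Matrix.diagonal fun _ => d) 0 0 W * unipotent u

variable [DecidableEq ι]

theorem isUnit_unipotent (u : ι → ℝ) : IsUnit (unipotent u) := by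
  rw [Matrix.isUnit_iff_isUnit_det, unipotent, Matrix.det_fromBlocks_zero₂₁]
  simp

theorem jacobiForm_eq_fromBlocks (d : ℝ) (u : ι → ℝ) (W : Matrix ι ι ℝ) :
    jacobiForm d u W = Matrix.fromBlocks (Matrix.diagonal fun _ => d)
      (Matrix.replicateRow Unit (d • u)) (Matrix.replicateCol Unit (d • u))
      (d • Matrix.vecMulVec u u + W) := by
  simp only [jacobiForm, unipotent, Matrix.fromBlocks_transpose, Matrix.fromBlocks_multiply]
  ext (i | i) (j | j) <;>
    simp [Matrix.mul_apply, Matrix.vecMulVec_apply] <;> ring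

theorem det_jacobiForm (d : ℝ) (u : ι → ℝ) (W : Matrix ι ι ℝ) :
    (jacobiForm d u W).det = d * W.det := by
  simp [jacobiForm, unipotent, Matrix.det_fromBlocks_zero₂₁]

theorem posDef_jacobiForm {d : ℝ} (hd : 0 < d) (u : ι → ℝ) {W : Matrix ι ι ℝ} (hW : W.PosDef) :
    (jacobiForm d u W).PosDef := by
  refine posDef_congr ?_ (isUnit_unipotent u)
  have hWt : Wᵀ = W := by
    simpa [Matrix.conjTranspose_eq_transpose_of_trivial] using hW.1.eq
  refine Matrix.PosDef.of_dotProduct_mulVec_pos ?_ fun x hx => ?_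
  · rw [Matrix.IsHermitian, Matrix.conjTranspose_eq_transpose_of_trivial,
      Matrix.fromBlocks_transpose, hWt]
    simp
  · have hval : star x ⬝ᵥ (Matrix.fromBlocks (Matrix.diagonal fun _ : Unit => d) 0 0 W *ᵥ x) =
        d * x (Sum.inl ()) ^ 2 + (x ∘ Sum.inr) ⬝ᵥ (W *ᵥ (x ∘ Sum.inr)) := by
      simp [Matrix.fromBlocks_mulVec, dotProduct]
      ring
    rw [hval]
    by_cases h : x ∘ Sum.inr = 0
    · have h0 : x (Sum.inl ()) ≠ 0 := by
        intro h0
        apply hx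
        ext (i | i)
        · exact h0
        · exact congrFun h i
      rw [h]
      simp only [zero_dotProduct, add_zero]
      positivity
    · have := hW.dotProduct_mulVec_pos h
      simp only [star_trivial] at this
      positivity

/-- Completing the square in the first variable. The remainder `W` is the Schur complement; it is
positive definite as a principal block of the form obtained by undoing the unipotent substitution.
-/
theorem exists_eq_jacobiForm {Z : Matrix (Unit ⊕ ι) (Unit ⊕ ι) ℝ} (hZ : Z.PosDef) :
    ∃ (u : ι → ℝ) (W : Matrix ι ι ℝ), W.PosDef ∧
      Z = jacobiForm (Z (Sum.inl ()) (Sum.inl ())) u W := by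
  have hZt : ∀ i j, Z i j = Z j i := fun i j => by
    simpa using (hZ.1.apply i j).symm
  set d := Z (Sum.inl ()) (Sum.inl ()) with hd
  have hd0 : 0 < d := hZ.diag_pos
  let u : ι → ℝ := fun j => Z (Sum.inl ()) (Sum.inr j) / d
  let W : Matrix ι ι ℝ := Matrix.of fun i j => Z (Sum.inr i) (Sum.inr j) - d * u i * u j
  have hZW : Z = jacobiForm d u W := by
    rw [jacobiForm_eq_fromBlocks]
    ext (i | i) (j | j)
    · simp [hd]
    · simp only [Matrix.fromBlocks_apply₁₂, Matrix.replicateRow_apply, Pi.smul_apply, smul_eq_mul, u]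
      field_simp
    · simp [u, hZt (Sum.inr i)]; field_simp
    · simp [W, Matrix.vecMulVec_apply]; ring
  refine ⟨u, W, ?_, hZW⟩
  have huu : unipotent u * unipotent (-u) = 1 := by
    simp only [unipotent, Matrix.fromBlocks_multiply, ← Matrix.fromBlocks_one]
    congr 1 <;> ext <;> simp
  have h1 := posDef_congr hZ (isUnit_unipotent (-u))
  have h2 : (unipotent (-u))ᵀ * Z * unipotent (-u) =
      Matrix.fromBlocks (Matrix.diagonal fun _ => d) 0 0 W := by
    rw [hZW, jacobiForm]
    have : (unipotent (-u))ᵀ * (unipotent u)ᵀ = 1 := by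
      rw [← Matrix.transpose_mul, huu, Matrix.transpose_one]
    calc _ = ((unipotent (-u))ᵀ * (unipotent u)ᵀ) *
          Matrix.fromBlocks (Matrix.diagonal fun _ => d) 0 0 W *
            (unipotent u * unipotent (-u)) := by simp only [Matrix.mul_assoc]
      _ = _ := by rw [this, huu, Matrix.one_mul, Matrix.mul_one]
  rw [h2] at h1
  exact h1.submatrix (e := Sum.inr) Sum.inr_injective

/-- Integral substitutions fixing the first basis vector leave `d` alone, shift `u` by integers and
act on `W` by `B`. This is what lets `u` be rounded while `W` is being reduced. -/
theorem intCongr_jacobiForm (d : ℝ) (u : ι → ℝ) (W : Matrix ι ι ℝ) (s : ι → ℤ)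
    (B : Matrix ι ι ℤ) :
    intCongr (Matrix.fromBlocks 1 (Matrix.replicateRow Unit s) 0 B) (jacobiForm d u W) =
      jacobiForm d (fun j => s j + (u ᵥ* B.map (Int.cast : ℤ → ℝ)) j) (intCongr B W) := by
  set C : Matrix ι ι ℝ := B.map (Int.cast : ℤ → ℝ) with hC
  set v : ι → ℝ := fun j => s j + (u ᵥ* C) j with hv
  have h1 : unipotent u *
      (Matrix.fromBlocks 1 (Matrix.replicateRow Unit s) 0 B).map (Int.cast : ℤ → ℝ) =
      Matrix.fromBlocks 1 0 0 C * unipotent v := by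
    rw [Matrix.fromBlocks_map, unipotent, unipotent, Matrix.fromBlocks_multiply,
      Matrix.fromBlocks_multiply]
    congr 1 <;> ext i j
    · simp
    · simp [hv, Matrix.mul_apply, Matrix.vecMul, dotProduct, hC]
    · simp
    · simp [hC]
  have h2 : (Matrix.fromBlocks 1 0 0 C : Matrix (Unit ⊕ ι) (Unit ⊕ ι) ℝ)ᵀ *
      Matrix.fromBlocks (Matrix.diagonal fun _ => d) 0 0 W * Matrix.fromBlocks 1 0 0 C =
      Matrix.fromBlocks (Matrix.diagonal fun _ => d) 0 0 (intCongr B W) := by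
    simp [Matrix.fromBlocks_transpose, Matrix.fromBlocks_multiply, intCongr, hC]
  rw [intCongr, jacobiForm, jacobiForm, ← h2]
  have h3 := congrArg Matrix.transpose h1
  rw [Matrix.transpose_mul, Matrix.transpose_mul] at h3
  simp only [← Matrix.mul_assoc]
  rw [h3, Matrix.mul_assoc _ (unipotent u), h1]
  simp only [Matrix.mul_assoc]

theorem continuous_jacobiForm :
    Continuous fun p : ℝ × (ι → ℝ) × Matrix ι ι ℝ => jacobiForm p.1 p.2.1 p.2.2 := by
  simp only [jacobiForm_eq_fromBlocks]
  refine continuous_matrix fun i j => ?_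
  rcases i with i | i <;> rcases j with j | j <;>
    simp [Matrix.vecMulVec_apply] <;> fun_prop

theorem exists_det_lower_bound {K : Set (Matrix ι ι ℝ)} (hK : IsCompact K)
    (hpos : ∀ Z ∈ K, Z.PosDef) : ∃ ε > 0, ∀ Z ∈ K, ε ≤ Z.det := by
  rcases K.eq_empty_or_nonempty with rfl | hne
  · exact ⟨1, one_pos, by simp⟩
  · obtain ⟨Z₀, h₀, hmin⟩ := hK.exists_isMinOn hne
      (f := Matrix.det) (Continuous.matrix_det continuous_id).continuousOn
    exact ⟨_, (hpos _ h₀).det_pos, fun Z hZ => hmin hZ⟩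

/-- Hermite's argument: take a nearly minimal first diagonal entry, complete the square, and reduce
the remainder by induction. Near-minimality forces a lower bound on the values of the remainder. -/
theorem HasCompactReduction.unit_sum (h : HasCompactReduction ι) :
    HasCompactReduction (Unit ⊕ ι) := by
  intro inst c D hc
  obtain rfl : inst = instDecidableEqSum := Subsingleton.elim _ _
  -- The remainder has determinant `Z.det / d ≤ D / c`, and its diagonal values turn out to be at
  -- least `c / 2`; `c / 4` is a safe choice.
  obtain ⟨K, hK, hpos, hred⟩ := h (c / 4) (D / c) (by positivity)
  obtain ⟨ε, hε, hεK⟩ := exists_det_lower_bound hK hpos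
  refine ⟨(fun p : ℝ × (ι → ℝ) × Matrix ι ι ℝ => jacobiForm p.1 p.2.1 p.2.2) ''
    (Set.Icc c (D / ε) ×ˢ (Set.Icc (-1) 1 ×ˢ K)),
    (isCompact_Icc.prod (isCompact_Icc.prod hK)).image continuous_jacobiForm, ?_, ?_⟩
  · rintro _ ⟨⟨d, u, W⟩, ⟨hd, -, hW⟩, rfl⟩
    exact posDef_jacobiForm (hc.trans_le hd.1) u (hpos W hW)
  intro Z hZ hmin hdet
  let S : Set ℝ := {x | ∃ A : Matrix (Unit ⊕ ι) (Unit ⊕ ι) ℤ, IsUnit A.det ∧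
    intCongr A Z (Sum.inl ()) (Sum.inl ()) = x}
  have hSne : S.Nonempty := ⟨_, 1, by simp, rfl⟩
  have hSc : c ≤ sInf S := by
    refine le_csInf hSne ?_
    rintro _ ⟨A, hA, rfl⟩
    exact hmin A hA _
  have hSb : BddBelow S := ⟨c, by rintro _ ⟨A, hA, rfl⟩; exact hmin A hA _⟩
  -- A factor less than 2 from the infimum is enough, so attainment of the minimum is not needed.
  obtain ⟨_, ⟨A, hA, rfl⟩, hA2⟩ := exists_lt_of_csInf_lt hSne
    (show sInf S < 2 * sInf S by linarith)
  obtain ⟨u, W, hW, hZW⟩ := exists_eq_jacobiForm (posDef_intCongr hA hZ)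
  have hdc := hmin A hA (Sum.inl ())
  set d := intCongr A Z (Sum.inl ()) (Sum.inl ()) with hd
  have hd0 : 0 < d := hc.trans_le hdc
  have hdetW : d * W.det = Z.det := by
    rw [← det_jacobiForm d u W, ← hZW, det_intCongr hA]
  have key : ∀ B : Matrix ι ι ℤ, IsUnit B.det → ∃ (C : Matrix (Unit ⊕ ι) (Unit ⊕ ι) ℤ)
      (v : ι → ℝ), IsUnit C.det ∧ (∀ j, |v j| ≤ 1 / 2) ∧
      intCongr C Z = jacobiForm d v (intCongr B W) := by
    intro B hB
    set w := u ᵥ* B.map (Int.cast : ℤ → ℝ) with hw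
    refine ⟨A * Matrix.fromBlocks 1 (Matrix.replicateRow Unit fun j => -round (w j)) 0 B,
      fun j => ((-round (w j) : ℤ) : ℝ) + w j, ?_, fun j => ?_, ?_⟩
    · rw [Matrix.det_mul, Matrix.det_fromBlocks_zero₂₁]
      simpa using hA.mul hB
    · have := abs_sub_round (w j)
      simpa only [Int.cast_neg, neg_add_eq_sub] using this
    · rw [intCongr_mul, hZW, intCongr_jacobiForm]
  -- Each diagonal entry `d * v j ^ 2 + W' j j`, with `W' = intCongr B W`, is at least `sInf S`. As
  -- `|v j| ≤ 1 / 2` and `d < 2 * sInf S`, the first summand is at most `sInf S / 2`.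
  obtain ⟨B, hB, hBK⟩ := hred W hW (fun B hB j => by
      obtain ⟨C, v, hC, hv, hCv⟩ := key B hB
      obtain ⟨C', hC', hCC⟩ := exists_isUnit_intCongr_apply_eq hC Z (Sum.inl ()) (Sum.inr j)
      have h1 : sInf S ≤ intCongr C Z (Sum.inr j) (Sum.inr j) :=
        csInf_le hSb ⟨C', hC', hCC⟩
      rw [hCv, jacobiForm_eq_fromBlocks] at h1
      simp only [Matrix.fromBlocks_apply₂₂, Matrix.add_apply, Matrix.smul_apply,
        Matrix.vecMulVec_apply, smul_eq_mul] at h1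
      have h2 : v j * v j ≤ 1 / 4 := by
        have := abs_le.1 (hv j)
        nlinarith
      nlinarith)
    (by
      rw [le_div_iff₀ hc]
      nlinarith [hW.det_pos])
  obtain ⟨C, v, hC, hv, hCv⟩ := key B hB
  refine ⟨C, hC, ⟨d, v, intCongr B W⟩, ⟨⟨hdc, ?_⟩, ⟨fun j => ?_, fun j => ?_⟩, hBK⟩, hCv.symm⟩
  -- The upper bound on `d` comes from `d * W.det = Z.det ≤ D` and the positive lower bound of the
  -- determinant on `K`.
  · have := hεK _ hBK
    rw [det_intCongr hB] at this
    rw [le_div_iff₀ hε]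
    nlinarith
  · have := (abs_le.1 (hv j)).1
    simp only [Pi.neg_apply, Pi.one_apply]
    linarith
  · have := (abs_le.1 (hv j)).2
    simp only [Pi.one_apply]
    linarith

theorem hasCompactReduction (ι : Type*) [Fintype ι] : HasCompactReduction ι := by
  refine Fintype.induction_empty_option (P := fun α _ => HasCompactReduction α) ?_ ?_ ?_ ι
  · intro α β _ e h
    exact @HasCompactReduction.of_equiv β _ α (Fintype.ofEquiv β e.symm) e h
  · exact HasCompactReduction.of_isEmpty
  · intro α _ h
    classical
    exact HasCompactReduction.of_equiv
      ((Equiv.optionEquivSumPUnit α).trans (Equiv.sumComm _ _)).symm h.unit_sum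

end Reduction

/-! ### Determinant bounds for skew forms relative to a positive definite form -/

theorem one_add_sum_le_prod_one_add {ι : Type*} (s : Finset ι) {f : ι → ℝ}
    (hf : ∀ i, 0 ≤ f i) : 1 + ∑ i ∈ s, f i ≤ ∏ i ∈ s, (1 + f i) := by
  classical
  induction s using Finset.induction_on with
  | empty => simp
  | insert a s ha ih =>
    rw [Finset.sum_insert ha, Finset.prod_insert ha]
    nlinarith [hf a, Finset.sum_nonneg fun i (_ : i ∈ s) => hf i]

theorem sq_apply_le_trace {ι : Type*} [Fintype ι] (A : Matrix ι ι ℝ) (i j : ι) : A i j ^ 2 ≤ (Aᵀ * A).trace := by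
  simp only [Matrix.trace, Matrix.diag_apply, Matrix.mul_apply, Matrix.transpose_apply, ← sq]
  calc A i j ^ 2 ≤ ∑ k, A k j ^ 2 :=
        Finset.single_le_sum (f := fun k => A k j ^ 2) (fun k _ => sq_nonneg _) (Finset.mem_univ i)
    _ ≤ _ := Finset.single_le_sum (f := fun l => ∑ k, A k l ^ 2)
        (fun l _ => Finset.sum_nonneg fun k _ => sq_nonneg _) (Finset.mem_univ j)

section

variable {ι : Type*} [Fintype ι] [DecidableEq ι]

theorem one_add_trace_le_det_one_add {P : Matrix ι ι ℝ} (hP : P.PosSemidef) :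
    1 + P.trace ≤ (1 + P).det := by
  have h1 : (1 + P).det = ∏ i, (1 + hP.1.eigenvalues i) := by
    -- The characteristic polynomial at `-1` is `det (1 + P)` up to a sign, which cancels against
    -- that of the product over the eigenvalues.
    have h2 := Matrix.eval_charpoly P (-1)
    rw [hP.1.charpoly_eq, Polynomial.eval_prod] at h2
    have h3 : Matrix.scalar ι (-1 : ℝ) - P = -(1 + P) := by
      rw [map_neg, map_one]; abel
    have h4 : ∀ i, Polynomial.eval (-1 : ℝ)
        (Polynomial.X - Polynomial.C ((hP.1.eigenvalues i : ℝ))) =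
        (-1) * (1 + hP.1.eigenvalues i) := fun i => by simp; ring
    rw [h3, Matrix.det_neg] at h2
    simp only [RCLike.ofReal_real_eq_id, id_eq, h4] at h2
    rw [Finset.prod_mul_distrib, Finset.prod_const, Finset.card_univ] at h2
    exact (mul_left_cancel₀ (pow_ne_zero _ (by norm_num)) h2).symm
  have h2 : P.trace = ∑ i, hP.1.eigenvalues i := by
    simpa using hP.1.trace_eq_sum_eigenvalues
  rw [h1, h2]
  exact one_add_sum_le_prod_one_add _ hP.eigenvalues_nonneg

/-- Transposition gives `det (1 - K) = det (1 + K)`, and `(1 + K) * (1 - K) = 1 + Kᵀ * K` for skew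
`K`. -/
theorem det_one_sub_sq_eq {K : Matrix ι ι ℝ} (hK : Kᵀ = -K) :
    (1 - K).det ^ 2 = (1 + Kᵀ * K).det := by
  have h : (1 - K).det = (1 - K)ᵀ.det := (Matrix.det_transpose _).symm
  rw [sq]
  nth_rw 1 [h]
  rw [← Matrix.det_mul, Matrix.transpose_sub, Matrix.transpose_one, hK]
  congr 1
  noncomm_ring

theorem exists_transpose_mul_self {Z : Matrix ι ι ℝ} (hZ : Z.PosDef) :
    ∃ L : Matrix ι ι ℝ, IsUnit L.det ∧ Z = Lᵀ * L := by
  open scoped MatrixOrder Matrix.Norms.L2Operator in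
  obtain ⟨L, hL⟩ := CStarAlgebra.nonneg_iff_eq_star_mul_self.1 hZ.posSemidef.nonneg
  rw [Matrix.star_eq_conjTranspose, Matrix.conjTranspose_eq_transpose_of_trivial] at hL
  refine ⟨L, ?_, hL⟩
  have := hZ.det_pos
  rw [hL, Matrix.det_mul] at this
  exact (right_ne_zero_of_mul this.ne').isUnit

/-- A skew form `T` all of whose invariants relative to `Z` are bounded has bounded entries in terms
of the diagonal entries of `Z`. -/
theorem abs_apply_le_of_det_sub_sq_le {Z T : Matrix ι ι ℝ} (hZ : Z.PosDef) (hT : Tᵀ = -T)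
    {E b e : ℝ} (hdet : (Z - T).det ^ 2 ≤ E * Z.det ^ 2) (hb : 0 ≤ b) (he : 0 ≤ e)
    (hZb : ∀ i, Z i i ≤ b ^ 2) (hE : E ≤ e ^ 2) (i j : ι) :
    |T i j| ≤ ∑ _k : ι, ∑ _l : ι, b * e * b := by
  obtain ⟨L, hL, rfl⟩ := exists_transpose_mul_self hZ
  -- `K` is `T` in a basis orthonormal for `Z`. The determinant hypothesis bounds its
  -- Hilbert–Schmidt norm, and `T = Lᵀ * K * L` is then estimated entrywise.
  set K : Matrix ι ι ℝ := (L⁻¹)ᵀ * T * L⁻¹ with hKdef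
  have hLi : L⁻¹ * L = 1 := Matrix.nonsing_inv_mul _ hL
  have hLit : Lᵀ * (L⁻¹)ᵀ = 1 := by rw [← Matrix.transpose_mul, hLi, Matrix.transpose_one]
  have hTK : T = Lᵀ * K * L := by
    calc T = (Lᵀ * (L⁻¹)ᵀ) * T * (L⁻¹ * L) := by rw [hLi, hLit, Matrix.one_mul, Matrix.mul_one]
      _ = _ := by rw [hKdef]; simp only [Matrix.mul_assoc]
  have hK : Kᵀ = -K := by
    rw [hKdef]
    simp [Matrix.transpose_mul, hT, Matrix.mul_assoc]
  have hdetK : (1 - K).det ^ 2 ≤ E := by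
    have h1 : Lᵀ * L - T = Lᵀ * (1 - K) * L := by
      rw [hTK]; noncomm_ring
    rw [h1, Matrix.det_mul, Matrix.det_mul, Matrix.det_mul, Matrix.det_transpose] at hdet
    have h0 : 0 < L.det ^ 4 := by
      have := hL.ne_zero
      positivity
    nlinarith
  have hKe : ∀ k l, |K k l| ≤ e := fun k l => by
    refine abs_le_of_sq_le_sq ?_ he
    have h1 := sq_apply_le_trace K k l
    have h2 : (Kᵀ * K).PosSemidef := by
      simpa [Matrix.conjTranspose_eq_transpose_of_trivial] using
        Matrix.posSemidef_conjTranspose_mul_self K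
    have h3 := one_add_trace_le_det_one_add h2
    rw [← det_one_sub_sq_eq hK] at h3
    linarith
  -- Column `l` of `L` has squared length equal to the `l`-th diagonal entry of `Lᵀ * L`.
  have hLb : ∀ k l, |L k l| ≤ b := fun k l => by
    refine abs_le_of_sq_le_sq (le_trans ?_ (hZb l)) hb
    simp only [Matrix.mul_apply, Matrix.transpose_apply, ← sq]
    exact Finset.single_le_sum (f := fun k => L k l ^ 2) (fun k _ => sq_nonneg _)
      (Finset.mem_univ k)
  rw [hTK, Matrix.mul_apply]
  refine (Finset.abs_sum_le_sum_abs _ _).trans (Finset.sum_le_sum fun k _ => ?_)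
  rw [Matrix.mul_apply, Finset.sum_mul]
  refine (Finset.abs_sum_le_sum_abs _ _).trans (Finset.sum_le_sum fun l _ => ?_)
  rw [abs_mul, abs_mul, Matrix.transpose_apply]
  have h1 := hLb l i
  have h2 := hKe l k
  have h3 := hLb k j
  gcongr

end

/-! ### The symplectic invariants through a determinant -/

theorem J_transpose (n : ℕ) : (J n)ᵀ = -J n := by
  simp [J, Matrix.fromBlocks_transpose, Matrix.fromBlocks_neg]

/-- The characteristic polynomial at `1`: each pair `± i d_k` contributes `(1 - i d_k)(1 + i d_k)`.
-/
theorem det_one_sub_inv_mul_J {n : ℕ} (Y : PosDefMat n) :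
    (1 - Y.1⁻¹ * J n).det = ∏ k, (1 + d Y k ^ 2) := by
  have h := congrArg (Polynomial.eval 1) (charpoly_eq_prod_d Y)
  rw [Polynomial.eval_one_map, Matrix.eval_charpoly, map_one, Polynomial.eval_prod] at h
  have h2 : ∀ k, Polynomial.eval (1 : ℂ)
      ((Polynomial.X - Polynomial.C (Complex.I * (d Y k : ℂ))) *
        (Polynomial.X - Polynomial.C (-(Complex.I * (d Y k : ℂ))))) =
      ((1 + d Y k ^ 2 : ℝ) : ℂ) := fun k => by
    simp only [Polynomial.eval_mul, Polynomial.eval_sub, Polynomial.eval_X, Polynomial.eval_C]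
    push_cast
    linear_combination (-(d Y k : ℂ) ^ 2) * Complex.I_sq
  simp only [h2, ← Complex.ofReal_prod] at h
  exact Complex.ofReal_injective h

theorem det_sub_J {n : ℕ} (Y : PosDefMat n) :
    (Y.1 - J n).det = Y.1.det * ∏ k, (1 + d Y k ^ 2) := by
  rw [← det_one_sub_inv_mul_J, ← Matrix.det_mul, Matrix.mul_sub, Matrix.mul_one,
    Matrix.mul_nonsing_inv_cancel_left _ _ (Y.2.isUnit.map Matrix.detMonoidHom)]

/-- Turns the eigenvalue bound into a polynomial inequality in `Y`, which is evidently closed and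
whose two sides scale alike under congruence of `Y` and `J`. -/
theorem det_sub_J_sq_le {n : ℕ} (Y : PosDefMat n) {C : ℝ} (hC : ∀ k, d Y k ≤ C) :
    (Y.1 - J n).det ^ 2 ≤ ((1 + C ^ 2) ^ n) ^ 2 * Y.1.det ^ 2 := by
  have h : ∏ k, (1 + d Y k ^ 2) ≤ (1 + C ^ 2) ^ n := by
    calc _ ≤ ∏ _k : Fin n, (1 + C ^ 2) :=
          Finset.prod_le_prod (fun k _ => by positivity) fun k _ => by
            have := d_pos Y k
            have := hC k
            gcongr
      _ = _ := by simp
  have h0 : 0 ≤ ∏ k, (1 + d Y k ^ 2) := Finset.prod_nonneg fun k _ => by positivity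
  rw [det_sub_J, mul_pow, mul_comm]
  gcongr

/-! ### Topology of the quotient and closed conditions on forms -/

variable {n : ℕ}

theorem continuous_pull (β : GL (Idx n) ℝ) : Continuous fun Y : PosDefMat n => pull Y β :=
  Continuous.subtype_mk (by fun_prop) _

instance instContinuousConstSMulPiGroup (r : DivTuple n) :
    ContinuousConstSMul (PiGroup r).op (PosDefMat n) :=
  ⟨fun g => continuous_pull g.1.unop⟩

theorem isOpenMap_mk (r : DivTuple n) :
    IsOpenMap (Quotient.mk (orbitSetoid r) : PosDefMat n → ModuliSpace r) :=
  isOpenMap_quotient_mk'_mul (Γ := (PiGroup r).op) (T := PosDefMat n)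

theorem pull_mul (Y : PosDefMat n) (α β : GL (Idx n) ℝ) :
    pull Y (α * β) = pull (pull Y α) β :=
  mul_smul (MulOpposite.op β) (MulOpposite.op α) Y

theorem quadForm_nonneg (Y : PosDefMat n) (a : Idx n → ℝ) : 0 ≤ quadForm Y a := by
  simpa [quadForm] using Y.2.posSemidef.dotProduct_mulVec_nonneg a

theorem mr_le_quadForm (r : DivTuple n) (Y : PosDefMat n) {a : Idx n → ℤ} (ha : a ≠ 0) :
    mr r Y ≤ quadForm Y ((delta r : Matrix (Idx n) (Idx n) ℝ) *ᵥ fun i => (a i : ℝ)) :=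
  ciInf_le (f := fun a : {a : Idx n → ℤ // a ≠ 0} =>
    quadForm Y ((delta r : Matrix (Idx n) (Idx n) ℝ) *ᵥ fun i => (a.1 i : ℝ)))
    ⟨0, by rintro _ ⟨a, rfl⟩; exact quadForm_nonneg _ _⟩ ⟨a, ha⟩

/-- Positive definite forms with bounded minimum, determinant and symplectic invariants. -/
def boundedForms (r : DivTuple n) (C₀ C₁ E : ℝ) : Set (PosDefMat n) :=
  {Y | (∀ a : Idx n → ℤ, a ≠ 0 →
      C₀ ≤ quadForm Y ((delta r : Matrix (Idx n) (Idx n) ℝ) *ᵥ fun i => (a i : ℝ))) ∧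
    Y.1.det ≤ C₁ ∧ (Y.1 - J n).det ^ 2 ≤ E * Y.1.det ^ 2}

/-- The minimum is imposed vector by vector and the invariants through determinants, so neither `mr`
nor the eigenvalues need be shown continuous. -/
theorem isClosed_boundedForms (r : DivTuple n) (C₀ C₁ E : ℝ) :
    IsClosed (boundedForms r C₀ C₁ E) := by
  have hdet : Continuous fun Y : PosDefMat n => Y.1.det :=
    Continuous.matrix_det continuous_subtype_val
  have hdetJ : Continuous fun Y : PosDefMat n => (Y.1 - J n).det :=
    Continuous.matrix_det (continuous_subtype_val.sub continuous_const)
  have hquad : ∀ a : Idx n → ℝ, Continuous fun Y : PosDefMat n => quadForm Y a := fun a => by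
    unfold quadForm
    exact continuous_const.dotProduct (continuous_subtype_val.matrix_mulVec continuous_const)
  refine IsClosed.and ?_ (IsClosed.and ?_ ?_)
  · simp only [Set.ofPred_forall]
    exact isClosed_iInter fun a => isClosed_iInter fun _ => isClosed_le continuous_const (hquad _)
  · exact isClosed_le hdet continuous_const
  · exact isClosed_le (hdetJ.pow 2) (continuous_const.mul (hdet.pow 2))

/-! ### The integral Gram matrix of `J` and changes of lattice basis -/

/-- The matrix of the form `J` on the lattice `δ_r ℤ²ⁿ`. -/
def latticeJ (r : DivTuple n) : Matrix (Idx n) (Idx n) ℤ :=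
  Matrix.fromBlocks 0 (Matrix.diagonal fun i => (r.val i : ℤ))
    (-Matrix.diagonal fun i => (r.val i : ℤ)) 0

theorem coe_delta (r : DivTuple n) :
    (delta r : Matrix (Idx n) (Idx n) ℝ) = Matrix.diagonal r.diag := rfl

theorem latticeJ_map (r : DivTuple n) :
    (latticeJ r).map (Int.cast : ℤ → ℝ) =
      (delta r : Matrix (Idx n) (Idx n) ℝ)ᵀ * J n * (delta r : Matrix (Idx n) (Idx n) ℝ) := by
  rw [coe_delta, Matrix.diagonal_transpose]
  ext (i | i) (j | j) <;>
    simp [latticeJ, J, DivTuple.diag, Matrix.one_apply, Matrix.diagonal_apply]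
  split_ifs with h <;> simp [h]

/-- The inclusion of `GL(2n; ℤ)` in `GL(2n; ℝ)`. -/
noncomputable def castGL (n : ℕ) : GL (Idx n) ℤ →* GL (Idx n) ℝ :=
  Matrix.GeneralLinearGroup.map (n := Idx n) (Int.castRingHom ℝ)

theorem coe_castGL (A : GL (Idx n) ℤ) :
    (castGL n A : Matrix (Idx n) (Idx n) ℝ) =
      (A : Matrix (Idx n) (Idx n) ℤ).map (Int.cast : ℤ → ℝ) := rfl

theorem coe_pull_delta_castGL (r : DivTuple n) (Y : PosDefMat n) (A : GL (Idx n) ℤ) :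
    (pull Y (delta r * castGL n A)).1 = intCongr (A : Matrix (Idx n) (Idx n) ℤ)
      (pull Y (delta r)).1 := by
  rw [pull_mul]
  rfl

theorem map_transpose_mul_latticeJ_mul (r : DivTuple n) (A : GL (Idx n) ℤ) :
    ((A : Matrix (Idx n) (Idx n) ℤ)ᵀ * latticeJ r * (A : Matrix (Idx n) (Idx n) ℤ)).map
        (Int.cast : ℤ → ℝ) =
      ((delta r * castGL n A : GL (Idx n) ℝ) : Matrix (Idx n) (Idx n) ℝ)ᵀ * J n *
        ((delta r * castGL n A : GL (Idx n) ℝ) : Matrix (Idx n) (Idx n) ℝ) := by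
  rw [map_intCast_mul, map_intCast_mul, latticeJ_map, Units.val_mul, Matrix.transpose_mul,
    coe_castGL, Matrix.transpose_map]
  simp only [Matrix.mul_assoc]

theorem mul_inv_mem_SpTilde {X Y : GL (Idx n) ℝ}
    (h : (X : Matrix (Idx n) (Idx n) ℝ)ᵀ * J n * (X : Matrix (Idx n) (Idx n) ℝ) =
      (Y : Matrix (Idx n) (Idx n) ℝ)ᵀ * J n * (Y : Matrix (Idx n) (Idx n) ℝ)) :
    X * Y⁻¹ ∈ SpTilde n := by
  left
  have h1 : (Y : Matrix (Idx n) (Idx n) ℝ) * ((Y⁻¹ : GL (Idx n) ℝ) : Matrix (Idx n) (Idx n) ℝ) = 1 := by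
    rw [← Units.val_mul, mul_inv_cancel, Units.val_one]
  have h2 := congrArg Matrix.transpose h1
  rw [Matrix.transpose_mul, Matrix.transpose_one] at h2
  set Z := ((Y⁻¹ : GL (Idx n) ℝ) : Matrix (Idx n) (Idx n) ℝ)
  rw [Units.val_mul, Matrix.transpose_mul]
  calc _ = Zᵀ * ((X : Matrix (Idx n) (Idx n) ℝ)ᵀ * J n * (X : Matrix (Idx n) (Idx n) ℝ)) * Z := by
        simp only [Matrix.mul_assoc]; rfl
    _ = (Zᵀ * (Y : Matrix (Idx n) (Idx n) ℝ)ᵀ) * J n * ((Y : Matrix (Idx n) (Idx n) ℝ) * Z) := by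
        rw [h]; simp only [Matrix.mul_assoc]
    _ = J n := by rw [h1, h2, Matrix.one_mul, Matrix.mul_one]

/-- Two bases of the lattice `δ_r ℤ²ⁿ` with the same Gram matrix for `J` are related by an
automorphism of the lattice preserving `J`. -/
theorem mul_inv_mem_PiGroup (r : DivTuple n) {A B : GL (Idx n) ℤ}
    (h : (A : Matrix (Idx n) (Idx n) ℤ)ᵀ * latticeJ r * (A : Matrix (Idx n) (Idx n) ℤ) =
      (B : Matrix (Idx n) (Idx n) ℤ)ᵀ * latticeJ r * (B : Matrix (Idx n) (Idx n) ℤ)) :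
    (delta r * castGL n A) * (delta r * castGL n B)⁻¹ ∈ PiGroup r := by
  refine ⟨⟨castGL n (A * B⁻¹), ⟨_, rfl⟩, ?_⟩, mul_inv_mem_SpTilde ?_⟩
  · simp [mul_assoc]
  · rw [← map_transpose_mul_latticeJ_mul, ← map_transpose_mul_latticeJ_mul, h]

theorem exists_castGL_reduction (r : DivTuple n) {C₀ : ℝ} (hC₀ : 0 < C₀) (C₁ : ℝ) :
    ∃ K : Set (PosDefMat n), IsCompact K ∧ ∀ Y : PosDefMat n,
      (∀ a : Idx n → ℤ, a ≠ 0 →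
        C₀ ≤ quadForm Y ((delta r : Matrix (Idx n) (Idx n) ℝ) *ᵥ fun i => (a i : ℝ))) →
      Y.1.det ≤ C₁ → ∃ A : GL (Idx n) ℤ, pull Y (delta r * castGL n A) ∈ K := by
  obtain ⟨K, hK, hpos, hred⟩ := hasCompactReduction (Idx n) C₀
    ((delta r : Matrix (Idx n) (Idx n) ℝ).det ^ 2 * C₁) hC₀
  refine ⟨Subtype.val ⁻¹' K, ?_, fun Y hmin hdet => ?_⟩
  -- Compactness passes to the subtype because `K` consists entirely of positive definite matrices.
  · refine Topology.IsInducing.subtypeVal.isCompact_preimage' hK ?_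
    intro Z hZ
    exact ⟨⟨Z, hpos Z hZ⟩, rfl⟩
  · obtain ⟨A, hA, hAK⟩ := hred (pull Y (delta r)).1 (pull Y (delta r)).2 (fun A hA j => by
        have ha : A.col j ≠ 0 := by
          intro h
          refine hA.ne_zero (Matrix.det_eq_zero_of_column_eq_zero j fun i => congrFun h i)
        have h1 := hmin _ ha
        rw [← quadForm_pull] at h1
        exact h1.trans_eq (intCongr_apply_self A _ j).symm) (by
        change ((delta r : Matrix (Idx n) (Idx n) ℝ)ᵀ * Y.1 *
          (delta r : Matrix (Idx n) (Idx n) ℝ)).det ≤ _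
        rw [Matrix.det_mul, Matrix.det_mul, Matrix.det_transpose]
        nlinarith [mul_le_mul_of_nonneg_left hdet
          (sq_nonneg (delta r : Matrix (Idx n) (Idx n) ℝ).det)])
    refine ⟨Matrix.GeneralLinearGroup.mk'' A hA, ?_⟩
    rw [Set.mem_preimage, coe_pull_delta_castGL]
    exact hAK

/-! ### Finitely many Gram matrices, and compact representatives -/

theorem finite_abs_apply_le {ι : Type*} [Finite ι] (b : ℝ) :
    {T : Matrix ι ι ℤ | ∀ i j, |(T i j : ℝ)| ≤ b}.Finite := by
  have h : (Set.univ.pi fun _ : ι => Set.univ.pi fun _ : ι =>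
      Set.Icc (-⌊b⌋) ⌊b⌋).Finite :=
    Set.Finite.pi fun _ => Set.Finite.pi fun _ => Set.finite_Icc _ _
  refine h.subset fun T hT i _ j _ => ?_
  have := hT i j
  rw [← Int.cast_abs, ← Int.le_floor] at this
  exact abs_le.1 this

theorem exists_compact_representatives (r : DivTuple n) {C₀ : ℝ} (hC₀ : 0 < C₀) (C₁ E : ℝ) :
    ∃ K : Set (PosDefMat n), IsCompact K ∧ ∀ Y ∈ boundedForms r C₀ C₁ E,
      ∃ β ∈ PiGroup r, pull Y β ∈ K := by
  obtain ⟨K, hK, hred⟩ := exists_castGL_reduction r hC₀ C₁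
  obtain ⟨c, hc⟩ := (hK.image (Continuous.matrix_trace continuous_subtype_val)).bddAbove
  -- `c` bounds the trace on `K`, hence every diagonal entry there. The maximum with `0` makes the
  -- square root safe whatever the sign of `c`.
  set b := Real.sqrt (max c 0) with hb
  set e := Real.sqrt (max E 0) with he
  have hb2 : c ≤ b ^ 2 := by
    rw [hb, Real.sq_sqrt (le_max_right _ _)]
    exact le_max_left _ _
  have he2 : E ≤ e ^ 2 := by
    rw [he, Real.sq_sqrt (le_max_right _ _)]
    exact le_max_left _ _
  let F : Set (Matrix (Idx n) (Idx n) ℤ) :=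
    {T | ∀ i j, |(T i j : ℝ)| ≤ ∑ _k : Idx n, ∑ _l : Idx n, b * e * b}
  have hF : F.Finite := finite_abs_apply_le _
  let P : Matrix (Idx n) (Idx n) ℤ → GL (Idx n) ℤ → Prop := fun T A =>
    (A : Matrix (Idx n) (Idx n) ℤ)ᵀ * latticeJ r * (A : Matrix (Idx n) (Idx n) ℤ) = T
  -- One basis change per Gram matrix. For a `T` that is not attained the value is arbitrary and
  -- only enlarges the compact union.
  let B : Matrix (Idx n) (Idx n) ℤ → GL (Idx n) ℤ := fun T => Classical.epsilon (P T)
  refine ⟨⋃ T ∈ F, (fun Y => pull Y (delta r * castGL n (B T))⁻¹) '' K,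
    hF.isCompact_biUnion fun T _ => hK.image (continuous_pull _), ?_⟩
  rintro Y ⟨hmin, hdet, hinv⟩
  obtain ⟨A, hA⟩ := hred Y hmin hdet
  set T := (A : Matrix (Idx n) (Idx n) ℤ)ᵀ * latticeJ r * (A : Matrix (Idx n) (Idx n) ℤ) with hT
  have hBT : P T (B T) := Classical.epsilon_spec (p := P T) ⟨A, rfl⟩
  refine ⟨_, mul_inv_mem_PiGroup r (hT.symm.trans hBT.symm), ?_⟩
  rw [pull_mul]
  refine Set.mem_biUnion (x := T) ?_ ⟨_, hA, rfl⟩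
  set X := delta r * castGL n A with hX
  have hTX := map_transpose_mul_latticeJ_mul r A
  rw [← hX, ← hT] at hTX
  have hskew : (T.map (Int.cast : ℤ → ℝ))ᵀ = -T.map (Int.cast : ℤ → ℝ) := by
    rw [hTX]
    simp [Matrix.transpose_mul, J_transpose, Matrix.mul_assoc]
  intro i j
  refine abs_apply_le_of_det_sub_sq_le (T := T.map (Int.cast : ℤ → ℝ)) (pull Y X).2 hskew
    (E := E) ?_ (Real.sqrt_nonneg _) (Real.sqrt_nonneg _) (fun i => ?_) he2 i j
  · have h1 : (pull Y X).1 = (X : Matrix (Idx n) (Idx n) ℝ)ᵀ * Y.1 *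
        (X : Matrix (Idx n) (Idx n) ℝ) := rfl
    rw [hTX, h1, ← Matrix.sub_mul, ← Matrix.mul_sub, Matrix.det_mul, Matrix.det_mul,
      Matrix.det_mul, Matrix.det_mul, Matrix.det_transpose]
    -- Congruence by `X` multiplies both sides of the inequality by `X.det ^ 4`.
    nlinarith [mul_le_mul_of_nonneg_left hinv
      (sq_nonneg ((X : Matrix (Idx n) (Idx n) ℝ).det ^ 2))]
  · refine le_trans ?_ ((hc ⟨_, hA, rfl⟩).trans hb2)
    exact Finset.single_le_sum (f := fun i => (pull Y X).1 i i)
      (fun k _ => (pull Y X).2.posSemidef.diag_nonneg) (Finset.mem_univ i)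

end HeisenbergModuli

theorem theorem3p13 (n : ℕ) (hn : 0 < n) (r : HeisenbergModuli.DivTuple n)
    (M : Set (HeisenbergModuli.ModuliSpace r)) (C₀ C₁ C₂ : ℝ)
    (hC₀ : 0 < C₀) (hC₁ : 0 < C₁) (hC₂ : 0 < C₂)
    (hm : ∀ y ∈ M, C₀ ≤ HeisenbergModuli.ModuliSpace.mr y)
    (hdet : ∀ y ∈ M, HeisenbergModuli.ModuliSpace.det y ≤ C₁)
    (hd : ∀ y ∈ M, HeisenbergModuli.ModuliSpace.d ⟨n - 1, Nat.sub_lt hn Nat.one_pos⟩ y ≤ C₂) :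
    IsCompact (closure M) := by
  open HeisenbergModuli in
  obtain ⟨K, hK, hred⟩ := exists_compact_representatives r hC₀ C₁ (((1 + C₂ ^ 2) ^ n) ^ 2)
  let π : PosDefMat n → ModuliSpace r := Quotient.mk (orbitSetoid r)
  have hπ : Continuous π := continuous_quot_mk
  have hsub : π ⁻¹' M ⊆ boundedForms r C₀ C₁ (((1 + C₂ ^ 2) ^ n) ^ 2) := by
    intro Y hY
    refine ⟨fun a ha => (hm _ hY).trans (mr_le_quadForm r Y ha), hdet _ hY,
      det_sub_J_sq_le Y fun k => ?_⟩
    -- The index `n - 1` is the last one, so its invariant dominates all the others.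
    exact (d_monotone Y (Fin.le_def.2 (Nat.le_sub_one_of_lt k.2))).trans (hd _ hY)
  -- A closed subset of a compact set is compact, so the quotient need not be known to be Hausdorff.
  refine (hK.image hπ).of_isClosed_subset isClosed_closure fun y hy => ?_
  obtain ⟨Y, rfl⟩ := Quotient.exists_rep y
  have hY : Y ∈ closure (π ⁻¹' M) := by
    rw [← (isOpenMap_mk r).preimage_closure_eq_closure_preimage hπ]
    exact hy
  obtain ⟨β, hβ, hβK⟩ := hred Y (closure_minimal hsub (isClosed_boundedForms _ _ _ _) hY)
  exact ⟨_, hβK, Quotient.sound ((orbitSetoid_iff r _ _).2 ⟨β, hβ, rfl⟩)⟩
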